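/- **Setting.** Let $d,S,A,H,k\ge 1$ be integers. States are $s=(s_1,\dots,s_d)\in\mathcal S=[S]^d$, actions are $a\in\mathcal A=[A]$, the horizon is $H$, the transition operator $T:\mathcal S\times\mathcal A\to\Delta(\mathcal S)$, the reward function $R:\mathcal S\times\mathcal A\to[0,1]$ and the initial distribution $d_1\in\Delta(\mathcal S)$ are arbitrary subject to the following: there is a set $\mathcal I_\star\subseteq[d]$ with $|\mathcal I_\star|\le k$ (unknown to the learner) such that, writing $s[\mathcal I]=(s_i)_{i\in\mathcal I}$, $$T(s'\mid s,a)=T_{\mathrm{en}}(s'[\mathcal I_\star]\mid s[\mathcal I_\star],a)\,T_{\mathrm{ex}}(s'[\mathcal I_\star^c]\mid s[\mathcal I_\star^c]),\quad R(s,a)=R_{\mathrm{en}}(s[\mathcal I_\star],a),\quad d_1(s)=d_{1,\mathrm{en}}(s[\mathcal I_\star])\,d_{1,\mathrm{ex}}(s[\mathcal I_\star^c]).$$ $\Pi$ is the set of one-step policies $\mathcal S\to\mathcal A$, $\Pi[\mathcal I]$ is the set of those depending only on $s[\mathcal I]$, $\Pi[\mathscr I_{\le k}]=\bigcup_{|\mathcal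 I|\le k}\Pi[\mathcal I]$, and $\Pi_{\mathrm{NS}}=\Pi^H$ is the set of non-stationary policies $\pi=(\pi_1,\dots,\pi_H)$. A policy is endogenous if all $\pi_h\in\Pi[\mathcal I_\star]$. $J(\pi)=\mathbb E_\pi[\sum_{h=1}^H r_h]$ with $r_h=R(s_h,a_h)$. For $\eta>0$ assume $\eta$-reachability: for all $h\in[H]$ and $s\in\mathcal S$, $\max_{\pi\in\Pi_{\mathrm{NS}}}\mathbb P_\pi(s_h[\mathcal I_\star]=s[\mathcal I_\star])$ is either $0$ or at least $\eta$. A finite set $\Psi\subseteq\Pi_{\mathrm{NS}}$ is an endogenous $\eta/2$-approximate policy cover for layer $h$ if all its members are endogenous and for all $s\in\mathcal S$, $\max_{\psi\in\Psi}\mathbb P_\psi(s_h[\mathcal I_\star]=s[\mathcal I_\star])\ge\max_{\pi\in\Pi_{\mathrm{NS}}}\mathbb P_\pi(s_h[\mathcal I_\star]=s[\mathcal I_\star])-\eta/2$. **Algorithm (ExoPSDP).** Input: $\epsilon,\delta\in(0,1)$, $k$, nonempty sets $\Psi^{(1)},\dots,\Psi^{(H)}\subseteq\Pi_{\mathrm{NS}}$,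 a dataset size $N$; put $\epsilon_0=\epsilon/(8S^kH)$. For $t=H,H-1,\dots,1$: collect $N$ fresh independent trajectories by drawing $\psi\sim\mathrm{Unf}(\Psi^{(t)})$, following $\psi$ at layers $<t$, playing $a_t\sim\mathrm{Unf}(\mathcal A)$ at layer $t$ and following $\widehat\pi^{(t+1)},\dots,\widehat\pi^{(H)}$ at layers $>t$; form $$\widehat V_t(\pi)=\frac1N\sum_{n=1}^N\frac{\mathbf 1\{a_{t,n}=\pi(s_{t,n})\}}{1/A}\sum_{t'=t}^H r_{t',n},\qquad \pi\in\Pi[\mathscr I_{\le k}];$$ enumerate the factor sets $\mathcal I\subseteq[d]$ with $|\mathcal I|\le k$ by increasing cardinality (in any order within one cardinality), take the first $\mathcal I$ with $\max_{\pi\in\Pi[\mathscr I_{\le k}]}\widehat V_t(\pi)\le\max_{\pi\in\Pi[\mathcal I]}\widehat V_t(\pi)+(1+1/k)^{k-|\mathcal I|}\epsilon_0$, and let $\widehat\pi^{(t)}$ be any maximizer of $\widehat V_t$ over $\Pi[\mathcal I]$ (if there is no such $\mathcal I$, report failure). Output $\widehat\pi=(\widehat\pi^{(1)},\dots,\widehat\pi^{(H)})$.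 **Theorem.** There is a universal constant $C_0>0$ such that for every $C\ge C_0$ the following holds for all data as above and all $\epsilon,\delta\in(0,1)$. Suppose that for every $t\in[H]$ the set $\Psi^{(t)}$ is an endogenous $\eta/2$-approximate policy cover for layer $t$ with $|\Psi^{(t)}|\le S^k$. Run ExoPSDP with $$N=\left\lfloor C\,\frac{A H^4k^3S^{3k}\log(dAH/\delta)}{\epsilon^2}\right\rfloor$$ trajectories per layer, with any enumeration order and any rule (a function of the layer and of the estimates) for breaking ties. Then with probability at least $1-\delta$ the algorithm does not fail and its output $\widehat\pi$ (i) is endogenous and (ii) satisfies $\max_{\pi\in\Pi_{\mathrm{NS}}}J(\pi)\le J(\widehat\pi)+\epsilon$. Furthermore, the algorithm always uses at most $N=O\big(AH^4k^3S^{3k}\log(dAH/\delta)/\epsilon^2\big)$ trajectories for each layer $t\in[H]$ (hence at most $HN$ in total). -/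

import Mathlib

/-! Exogenous Markov decision processes (ExoMDPs) and the algorithm ExoPSDP.
Layers `1, …, H` are indexed by `Fin H` (so layer `h` is the index `h - 1`). -/

namespace ExoMDP

noncomputable section

/-- States `s = (s_1, …, s_d)` with `d` factors, each taking `S` values. -/
abbrev State (d S : ℕ) := Fin d → Fin S

/-- The set `Π` of one-step (deterministic) policies. -/
abbrev OneStep (d S A : ℕ) := State d S → Fin A

/-- The set `Π_NS` of non-stationary policies `π = (π_1, …, π_H)`. -/
abbrev Policy (d S A H : ℕ) := Fin H → OneStep d S A

/-- Non-stationary randomized (Markov) behaviours, used to describe how data is collected. -/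
abbrev RandPolicy (d S A H : ℕ) := Fin H → State d S → PMF (Fin A)

/-- A tabular MDP on the factored state space: transition operator, reward function with values
in `[0,1]`, and initial state distribution. -/
structure MDP (d S A : ℕ) where
  T : State d S → Fin A → PMF (State d S)
  R : State d S → Fin A → ℝ
  R_mem : ∀ s a, R s a ∈ Set.Icc (0 : ℝ) 1
  d₁ : PMF (State d S)

variable {d S A H : ℕ}

/-- `I` is a set of endogenous factors of `M`: transitions, rewards and the initial distribution
factorize over the factors in `I` and those in the complement of `I`.
Here `I.restrict s` is the sub-vector `s[I]`. -/
def MDP.IsExo (M : MDP d S A) (I : Finset (Fin d)) : Prop :=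
  ∃ (Ten : (↥I → Fin S) → Fin A → PMF (↥I → Fin S))
    (Tex : (↥(Iᶜ) → Fin S) → PMF (↥(Iᶜ) → Fin S))
    (Ren : (↥I → Fin S) → Fin A → ℝ)
    (den : PMF (↥I → Fin S)) (dex : PMF (↥(Iᶜ) → Fin S)),
    (∀ s a s', M.T s a s' =
      Ten (I.restrict s) a (I.restrict s') * Tex (Iᶜ.restrict s) (Iᶜ.restrict s')) ∧
    (∀ s a, M.R s a = Ren (I.restrict s) a) ∧
    (∀ s, M.d₁ s = den (I.restrict s) * dex (Iᶜ.restrict s))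

/-- Law of `((s_1,a_1), …, (s_n,a_n))` when the process is in state `s` at the first step and
actions are drawn from `κ`. -/
def MDP.rollout (M : MDP d S A) :
    (n : ℕ) → RandPolicy d S A n → State d S → PMF (Fin n → State d S × Fin A)
  | 0, _, _ => PMF.pure Fin.elim0
  | n + 1, κ, s =>
    (κ 0 s).bind fun a =>
      (M.T s a).bind fun s' =>
        (M.rollout n (fun i => κ i.succ) s').map
          fun w => (Fin.cons (s, a) w : Fin (n + 1) → State d S × Fin A)

/-- Law of the state-action sequence of an episode of length `H`. -/
def MDP.episode (M : MDP d S A) (κ : RandPolicy d S A H) : PMF (Fin H → State d S × Fin A) :=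
  M.d₁.bind (M.rollout H κ)

/-- A deterministic policy viewed as a randomized one. -/
def Policy.toRand (π : Policy d S A H) : RandPolicy d S A H := fun h s => PMF.pure (π h s)

/-- `J(π)`, the expected total reward of `π`. -/
def MDP.J (M : MDP d S A) (π : Policy d S A H) : ℝ :=
  ∑ w : Fin H → State d S × Fin A,
    (M.episode π.toRand w).toReal * ∑ h, M.R (w h).1 (w h).2

/-- `d_h(s[I]; π) = P_π(s_h[I] = s[I])`. -/
def MDP.occ (M : MDP d S A) (π : Policy d S A H) (h : Fin H) (I : Finset (Fin d))
    (s : State d S) : ℝ :=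
  ((M.episode π.toRand).toOuterMeasure {w | I.restrict (w h).1 = I.restrict s}).toReal

/-- The one-step policy `π` acts on the factor set `I`, that is, `π ∈ Π[I]`. -/
def ActsOn (I : Finset (Fin d)) (π : OneStep d S A) : Prop :=
  ∀ s s' : State d S, I.restrict s = I.restrict s' → π s = π s'

/-- A non-stationary policy is endogenous if it acts only on the endogenous factors `I`. -/
def Endogenous (I : Finset (Fin d)) (π : Policy d S A H) : Prop :=
  ∀ h, ActsOn I (π h)

/-- The endogenous state space is `η`-reachable: for each layer and each endogenous state the
maximal reaching probability over `Π_NS` is at least `η` or equal to `0`. -/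
def MDP.Reachable (M : MDP d S A) (H : ℕ) (I : Finset (Fin d)) (η : ℝ) : Prop :=
  ∀ (h : Fin H) (s : State d S),
    (∃ π : Policy d S A H, η ≤ M.occ π h I s) ∨ (∀ π : Policy d S A H, M.occ π h I s = 0)

/-- `Ψ` is an endogenous `ε`-approximate policy cover for layer `h`. -/
def MDP.IsEndoCover (M : MDP d S A) (I : Finset (Fin d)) (ε : ℝ) (h : Fin H)
    (Ψ : Finset (Policy d S A H)) : Prop :=
  (∀ s : State d S, ∃ ψ ∈ Ψ, ∀ π : Policy d S A H, M.occ π h I s - ε ≤ M.occ ψ h I s) ∧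
  (∀ ψ ∈ Ψ, Endogenous I ψ)

/-! ### EndoPolicyOptimization -/

/-- The test `is_cover` for the factor set `I`:
`max_{π ∈ Π[𝓘_{≤k}]} V(π) ≤ max_{π ∈ Π[I]} V(π) + (1 + 1/k)^(k - |I|) ε`
(both maxima are over finite nonempty sets). -/
def IsCover (k : ℕ) (ε : ℝ) (V : OneStep d S A → ℝ) (I : Finset (Fin d)) : Prop :=
  ∀ π : OneStep d S A, (∃ J : Finset (Fin d), J.card ≤ k ∧ ActsOn J π) →
    ∃ π' : OneStep d S A, ActsOn I π' ∧
      V π ≤ V π' + (1 + 1 / (k : ℝ)) ^ (k - I.card) * ε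

/-- `out` is a possible output of EndoPolicyOptimization with precision `ε` on the estimates `V`:
the factor sets of size `0, 1, …, k` are enumerated by increasing size (in any order within one
size), and for the first set `I` that passes the test some maximizer of `V` over `Π[I]` is
returned; the output is `none` (FAIL) if no set passes. -/
def IsEPOOutput (k : ℕ) (ε : ℝ) (V : OneStep d S A → ℝ) : Option (OneStep d S A) → Prop
  | some σ => ∃ I : Finset (Fin d), I.card ≤ k ∧ IsCover k ε V I ∧
      (∀ J : Finset (Fin d), J.card < I.card → ¬ IsCover k ε V J) ∧
      ActsOn I σ ∧ ∀ π, ActsOn I π → V π ≤ V σ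
  | none => ∀ I : Finset (Fin d), I.card ≤ k → ¬ IsCover k ε V I

/-- `epo` implements EndoPolicyOptimization, with some enumeration order and some rule for
breaking ties (which may differ between layers). -/
def ImplementsEPO (k : ℕ) (ε : ℝ)
    (epo : Fin H → (OneStep d S A → ℝ) → Option (OneStep d S A)) : Prop :=
  ∀ t V, IsEPOOutput k ε V (epo t V)

/-! ### ExoPSDP -/

/-- What the learner observes in an episode: `(s_h, a_h, r_h)` for each layer `h`. -/
abbrev Trajectory (d S A H : ℕ) := Fin H → State d S × Fin A × ℝ

/-- `N` independent draws from `p`. -/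
def iid {α : Type*} (p : PMF α) : (N : ℕ) → PMF (Fin N → α)
  | 0 => PMF.pure Fin.elim0
  | N + 1 => p.bind fun x => (iid p N).map fun xs => (Fin.cons x xs : Fin (N + 1) → α)

/-- The behaviour `ψ ∘_t Unf(𝒜) ∘_{t+1} π`: follow `ψ` before layer `t`, play a uniformly random
action at layer `t`, follow `π` after layer `t`. -/
def explore [NeZero A] (t : Fin H) (ψ π : Policy d S A H) : RandPolicy d S A H := fun h s =>
  if h < t then PMF.pure (ψ h s)
  else if h = t then PMF.uniformOfFintype (Fin A)
  else PMF.pure (π h s)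

/-- Law of one trajectory collected by executing `Unf(Ψ) ∘_t Unf(𝒜) ∘_{t+1} π`. -/
def MDP.trajLaw [NeZero A] (M : MDP d S A) (t : Fin H) (Ψ : Finset (Policy d S A H))
    (hΨ : Ψ.Nonempty) (π : Policy d S A H) : PMF (Trajectory d S A H) :=
  (PMF.uniformOfFinset Ψ hΨ).bind fun ψ =>
    (M.episode (explore t ψ π)).map fun w h => ((w h).1, (w h).2, M.R (w h).1 (w h).2)

/-- The importance-weighted estimate, from the dataset `D`, of the expected reward collected in
layers `t, …, H` when the one-step policy `π` is used at layer `t`. -/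
def Vhat {N : ℕ} (t : Fin H) (D : Fin N → Trajectory d S A H) (π : OneStep d S A) : ℝ :=
  1 / (N : ℝ) * ∑ n, (if (D n t).2.1 = π (D n t).1 then (1 : ℝ) else 0) / (1 / (A : ℝ)) *
    ∑ h with t ≤ h, (D n h).2.2

/-- The main loop of ExoPSDP: `psdpLoop … n hn π` performs the backward steps for the layers with
index `n - 1, …, 0`, given the part of `π` at indices `≥ n` (the other entries of `π` are
placeholders that are never executed). A step collects `N` fresh trajectories, forms the
importance-weighted estimates and calls EndoPolicyOptimization; if that call fails, so does the
algorithm. The result is the output policy (`none` for failure) together with the number of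
trajectories used at each layer. -/
def MDP.psdpLoop [NeZero A] (M : MDP d S A) (N : ℕ)
    (Ψ : Fin H → Finset (Policy d S A H)) (hΨ : ∀ t, (Ψ t).Nonempty)
    (epo : Fin H → (OneStep d S A → ℝ) → Option (OneStep d S A)) :
    (n : ℕ) → n ≤ H → Policy d S A H → PMF (Option (Policy d S A H) × (Fin H → ℕ))
  | 0, _, π => PMF.pure (some π, fun _ => 0)
  | n + 1, hn, π =>
    (iid (M.trajLaw ⟨n, hn⟩ (Ψ ⟨n, hn⟩) (hΨ ⟨n, hn⟩) π) N).bind fun D =>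
      match epo ⟨n, hn⟩ (Vhat ⟨n, hn⟩ D) with
      | none => PMF.pure (none, Pi.single ⟨n, hn⟩ N)
      | some σ =>
        (M.psdpLoop N Ψ hΨ epo n (Nat.le_of_succ_le hn) (Function.update π ⟨n, hn⟩ σ)).map
          fun out => (out.1, out.2 + Pi.single ⟨n, hn⟩ N)

/-- ExoPSDP with dataset size `N` per layer and policy sets `Ψ`. -/
def MDP.exoPSDP [NeZero A] (M : MDP d S A) (N : ℕ)
    (Ψ : Fin H → Finset (Policy d S A H)) (hΨ : ∀ t, (Ψ t).Nonempty)
    (epo : Fin H → (OneStep d S A → ℝ) → Option (OneStep d S A)) :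
    PMF (Option (Policy d S A H) × (Fin H → ℕ)) :=
  M.psdpLoop N Ψ hΨ epo H le_rfl (fun _ _ => 0)

/-- The precision `ε₀ = ε / (8 S^k H)` passed to EndoPolicyOptimization. -/
def precision (S H k : ℕ) (ε : ℝ) : ℝ := ε / (8 * (S : ℝ) ^ k * H)

/-- `A H^4 k^3 S^(3k) log(dAH/δ) / ε^2`. -/
def sampleBound (d S A H k : ℕ) (ε δ : ℝ) : ℝ :=
  A * (H : ℝ) ^ 4 * (k : ℝ) ^ 3 * (S : ℝ) ^ (3 * k) * Real.log (d * A * H / δ) / ε ^ 2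

end

end ExoMDP

/-!
Write `v t π σ` (`MDP.layerValue`) for the average, over the cover `Ψ t`, of the reward collected in
the layers `≥ t` when the roll-in is from the cover, `σ` is used at layer `t` and `π` afterwards.

*Decoupling.* If roll-in and roll-out are endogenous, the endogenous and exogenous parts of the
state at layer `t` are independent, the law of the exogenous part is the same for all roll-ins
(`MDP.exists_expect_rollout_state_eq`), and the value at layer `t` depends only on the endogenous
part (`MDP.IsExo.qval_congr_state`). Freezing the exogenous part at its best value therefore turns
a policy acting on `J` into one acting on `J ∩ I` that is at least as good
(`MDP.IsExo.exists_actsOn_inter_le`).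

*Selection.* Let `ε₀` be the precision. When all estimates are accurate up to `ε₀ / (2 k)`, the
slacks `(1 + 1/k)^(k - |J|) ε₀` for consecutive cardinalities differ by at least twice the estimation
error. So a set `J ⊄ I` cannot be selected, as the smaller set `J ∩ I` would have passed, and the
selected policy is endogenous and `4 ε₀`-optimal, since `(1 + 1/k)^k + 1 ≤ 4`
(`IsEPOOutput.exists_eq_some`).

*Concentration.* The importance-weighted returns are unbiased, bounded by `A H`, and have second
moment at most `A H²`. A Bernstein bound and a union bound over the at most `d^k A^(S^k)` policies
acting on `k` factors give the accuracy with probability `1 - δ / H` per layer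
(`MDP.estimates_tail`, `sampleSize_spec`, `MDP.IsExo.step_failure_le`), and the failures of the
layers add up (`MDP.psdpLoop_failure_le`). With a single action the sample size may be zero, but then
there is only one policy.

*Optimality.* By the performance difference lemma, the suboptimality against `π'` is at most the sum
over layers of the expected gap `max_a Q(s, a) - Q(s, π s)` under `π'`. This gap is a nonnegative
function of the endogenous state, whose occupancy under `π'` is, by reachability, at most twice that
under some member of the cover, so at most `2 |Ψ t|` times the average over the cover
(`MDP.IsEndoCover.expect_le`). The greedy policy is endogenous, so the average gap is at most
`4 ε₀`, and the total loss is at most `H * 2 S^k * 4 ε₀ = ε` (`MDP.IsExo.J_le_of_layerValue_le`).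
-/

namespace ExoMDP

noncomputable section

/-! ### Expectations under finitely supported laws -/

lemma toOuterMeasure_le_one {α : Type*} (p : PMF α) (s : Set α) : p.toOuterMeasure s ≤ 1 :=
  (p.toOuterMeasure.mono s.subset_univ).trans_eq (by simp [PMF.toOuterMeasure_apply, p.tsum_coe])

section Expect

variable {α β : Type*} [Fintype α] [Fintype β]

/-- The expectation of a real function on a finite type. -/
def expect (p : PMF α) (f : α → ℝ) : ℝ := ∑ x, (p x).toReal * f x

lemma sum_toReal (p : PMF α) : ∑ x, (p x).toReal = 1 := by
  rw [← ENNReal.toReal_sum (fun x _ => p.apply_ne_top x), ← tsum_fintype (L := .unconditional _),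
    p.tsum_coe, ENNReal.toReal_one]

lemma expect_bind (p : PMF α) (q : α → PMF β) (f : β → ℝ) :
    expect (p.bind q) f = expect p fun x => expect (q x) f := by
  simp only [expect, PMF.bind_apply, tsum_fintype, Finset.mul_sum]
  rw [Finset.sum_comm]
  refine Finset.sum_congr rfl fun y _ => ?_
  rw [ENNReal.toReal_sum fun x _ => ENNReal.mul_ne_top (p.apply_ne_top x) ((q x).apply_ne_top y),
    Finset.sum_mul]
  simp [ENNReal.toReal_mul, mul_assoc]

lemma expect_pure (a : α) (f : α → ℝ) : expect (PMF.pure a) f = f a := by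
  classical
  simp only [expect, PMF.pure_apply]
  rw [Finset.sum_eq_single a] <;> simp +contextual

lemma expect_map (p : PMF α) (g : α → β) (f : β → ℝ) :
    expect (p.map g) f = expect p fun x => f (g x) := by
  rw [← PMF.bind_pure_comp, expect_bind]
  simp [expect_pure]

lemma expect_uniformOfFintype [Nonempty α] (f : α → ℝ) :
    expect (PMF.uniformOfFintype α) f = (Fintype.card α : ℝ)⁻¹ * ∑ x, f x := by
  simp [expect, Finset.mul_sum]

lemma expect_uniformOfFinset (s : Finset α) (hs : s.Nonempty) (f : α → ℝ) :
    expect (PMF.uniformOfFinset s hs) f = (s.card : ℝ)⁻¹ * ∑ x ∈ s, f x := by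
  classical
  rw [Finset.mul_sum, expect, ← Finset.sum_subset s.subset_univ]
  · exact Finset.sum_congr rfl fun x hx => by simp [PMF.uniformOfFinset_apply_of_mem hs hx]
  · intro x _ hx
    simp [PMF.uniformOfFinset_apply_of_notMem hs hx]

lemma expect_const (p : PMF α) (c : ℝ) : expect p (fun _ => c) = c := by
  rw [expect, ← Finset.sum_mul, sum_toReal, one_mul]

lemma expect_mono (p : PMF α) {f g : α → ℝ} (h : ∀ x, f x ≤ g x) : expect p f ≤ expect p g :=
  Finset.sum_le_sum fun x _ => mul_le_mul_of_nonneg_left (h x) ENNReal.toReal_nonneg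

lemma expect_nonneg (p : PMF α) {f : α → ℝ} (h : ∀ x, 0 ≤ f x) : 0 ≤ expect p f :=
  Finset.sum_nonneg fun x _ => mul_nonneg ENNReal.toReal_nonneg (h x)

lemma expect_add (p : PMF α) (f g : α → ℝ) :
    expect p (fun x => f x + g x) = expect p f + expect p g := by
  simp [expect, mul_add, Finset.sum_add_distrib]

lemma expect_sub (p : PMF α) (f g : α → ℝ) :
    expect p (fun x => f x - g x) = expect p f - expect p g := by
  simp [expect, mul_sub, Finset.sum_sub_distrib]

lemma expect_mul_left (p : PMF α) (c : ℝ) (f : α → ℝ) :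
    expect p (fun x => c * f x) = c * expect p f := by
  simp only [expect, Finset.mul_sum]
  exact Finset.sum_congr rfl fun x _ => by ring

lemma expect_sum {ι : Type*} (p : PMF α) (t : Finset ι) (f : ι → α → ℝ) :
    expect p (fun x => ∑ i ∈ t, f i x) = ∑ i ∈ t, expect p (f i) := by
  simp only [expect, Finset.mul_sum]
  rw [Finset.sum_comm]

lemma expect_comm (p : PMF α) (q : PMF β) (f : α → β → ℝ) :
    (expect p fun x => expect q (f x)) = expect q fun y => expect p fun x => f x y := by
  simp only [expect, Finset.mul_sum]
  rw [Finset.sum_comm]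
  exact Finset.sum_congr rfl fun _ _ => Finset.sum_congr rfl fun _ _ => by ring

lemma exists_expect_le (p : PMF α) (f : α → ℝ) : ∃ x, expect p f ≤ f x := by
  have : Nonempty α := let ⟨x, _⟩ := p.support_nonempty; ⟨x⟩
  obtain ⟨x, hx⟩ := Finite.exists_max f
  exact ⟨x, (expect_mono p hx).trans_eq (expect_const p _)⟩

lemma toReal_toOuterMeasure (p : PMF α) (s : Set α) :
    (p.toOuterMeasure s).toReal = expect p (s.indicator fun _ => 1) := by
  classical
  rw [PMF.toOuterMeasure_apply_fintype, ENNReal.toReal_sum]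
  · refine Finset.sum_congr rfl fun x _ => ?_
    by_cases hx : x ∈ s <;> simp [hx]
  · intro x _
    by_cases hx : x ∈ s <;> simp [hx, p.apply_ne_top x]

lemma toOuterMeasure_le_ofReal_expect (p : PMF α) {s : Set α} {f : α → ℝ} (h0 : ∀ x, 0 ≤ f x)
    (h1 : ∀ x ∈ s, 1 ≤ f x) : p.toOuterMeasure s ≤ ENNReal.ofReal (expect p f) := by
  refine (ENNReal.le_ofReal_iff_toReal_le ?_ (expect_nonneg p h0)).2 ?_
  · exact ((toOuterMeasure_le_one p s).trans_lt ENNReal.one_lt_top).ne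
  · rw [toReal_toOuterMeasure]
    exact expect_mono p fun x => Set.indicator_apply_le' (h1 x) fun _ => h0 x

end Expect

lemma toOuterMeasure_bind_le {α β : Type*} (p : PMF α) (f : α → PMF β) (s : Set β) (B : Set α)
    (c : ENNReal) (h : ∀ x ∉ B, (f x).toOuterMeasure s ≤ c) :
    (p.bind f).toOuterMeasure s ≤ p.toOuterMeasure B + c := by
  rw [PMF.toOuterMeasure_bind_apply, PMF.toOuterMeasure_apply]
  calc ∑' x, p x * (f x).toOuterMeasure s
      ≤ ∑' x, (B.indicator p x + p x * c) := by
        refine ENNReal.tsum_le_tsum fun x => ?_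
        by_cases hx : x ∈ B
        · rw [Set.indicator_of_mem hx]
          exact (mul_le_of_le_one_right' (toOuterMeasure_le_one _ _)).trans le_self_add
        · rw [Set.indicator_of_notMem hx, zero_add]
          gcongr
          exact h x hx
    _ = ∑' x, B.indicator p x + c := by
        rw [ENNReal.tsum_add, ENNReal.tsum_mul_right, p.tsum_coe, one_mul]

lemma ofReal_one_sub_le_toOuterMeasure {α : Type*} (p : PMF α) (s : Set α) {δ : ℝ}
    (hδ : 0 ≤ δ) (h : p.toOuterMeasure sᶜ ≤ ENNReal.ofReal δ) :
    ENNReal.ofReal (1 - δ) ≤ p.toOuterMeasure s := by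
  have h1 : (1 : ENNReal) ≤ p.toOuterMeasure s + p.toOuterMeasure sᶜ := by
    refine le_trans (le_of_eq ?_) (MeasureTheory.measure_union_le s sᶜ)
    simp [PMF.toOuterMeasure_apply, p.tsum_coe]
  rw [ENNReal.ofReal_sub _ hδ, ENNReal.ofReal_one]
  exact tsub_le_iff_right.2 (h1.trans (by gcongr))

/-! ### Concentration of empirical means -/

lemma iid_map {α β : Type*} (p : PMF α) (f : α → β) :
    ∀ N, iid (p.map f) N = (iid p N).map fun D n => f (D n)
  | 0 => by
    simp only [iid, PMF.pure_map]
    congr 1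
    exact Subsingleton.elim _ _
  | N + 1 => by
    simp only [iid, iid_map p f N, PMF.map_bind, PMF.bind_map, PMF.map_comp, Function.comp_def]
    congr 1
    funext x
    congr 1
    funext D n
    refine Fin.cases ?_ (fun i => ?_) n <;> simp

section Concentration

variable {α : Type*} [Fintype α]

lemma expect_iid_exp_sum (p : PMF α) (X : α → ℝ) :
    ∀ N, expect (iid p N) (fun D => Real.exp (∑ n, X (D n))) =
      expect p (fun x => Real.exp (X x)) ^ N
  | 0 => by simp [iid, expect_pure]
  | N + 1 => by
    simp only [iid, expect_bind, expect_map, Fin.sum_univ_succ, Fin.cons_zero, Fin.cons_succ,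
      Real.exp_add, expect_mul_left, expect_iid_exp_sum p X N]
    simp only [mul_comm _ (expect p _ ^ N), expect_mul_left, pow_succ]

/-- One-sided Bernstein inequality in terms of the second moment. -/
lemma iid_upper_tail (p : PMF α) (X : α → ℝ) {B v b : ℝ} (hB : ∀ x, |X x| ≤ B)
    (hv : expect p (fun x => X x ^ 2) ≤ v) (hv0 : 0 < v) (hb : 0 < b) (hbB : b * B ≤ 2 * v)
    (N : ℕ) :
    (iid p N).toOuterMeasure {D | N * (expect p X + b) ≤ ∑ n, X (D n)} ≤
      ENNReal.ofReal (Real.exp (-(N * b ^ 2 / (4 * v)))) := by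
  -- the minimizer of `l ^ 2 * v - l * b`
  set l : ℝ := b / (2 * v) with hl
  have hl0 : 0 < l := by positivity
  have hmgf : expect p (fun x => Real.exp (l * X x)) ≤ Real.exp (l * expect p X + l ^ 2 * v) := by
    have h1 : ∀ x, Real.exp (l * X x) ≤ 1 + l * X x + l ^ 2 * X x ^ 2 := fun x => by
      have hx : |l * X x| ≤ 1 := by
        rw [abs_mul, abs_of_pos hl0]
        calc l * |X x| ≤ l * B := by gcongr; exact hB x
          _ = b * B / (2 * v) := by rw [hl]; ring
          _ ≤ 1 := (div_le_one (by positivity)).2 hbB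
      have := (abs_le.1 (Real.abs_exp_sub_one_sub_id_le hx)).2
      rw [mul_pow] at this
      linarith
    refine (expect_mono p h1).trans ?_
    rw [expect_add, expect_add, expect_const, expect_mul_left, expect_mul_left]
    have := Real.add_one_le_exp (l * expect p X + l ^ 2 * v)
    have : l ^ 2 * expect p (fun x => X x ^ 2) ≤ l ^ 2 * v := by gcongr
    linarith
  refine (toOuterMeasure_le_ofReal_expect (iid p N)
    (f := fun D => Real.exp (-(l * (N * (expect p X + b)))) * Real.exp (∑ n, l * X (D n)))
    (fun D => by positivity) fun D hD => ?_).trans (ENNReal.ofReal_le_ofReal ?_)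
  · rw [← Real.exp_add, ← Finset.mul_sum]
    refine Real.one_le_exp ?_
    have := mul_le_mul_of_nonneg_left (show N * (expect p X + b) ≤ ∑ n, X (D n) from hD) hl0.le
    linarith
  · rw [expect_mul_left, expect_iid_exp_sum p (fun x => l * X x)]
    calc _ ≤ Real.exp (-(l * (N * (expect p X + b)))) *
          Real.exp (l * expect p X + l ^ 2 * v) ^ N := by
          gcongr
          exact expect_nonneg p fun x => (Real.exp_pos _).le
      _ = _ := by
          rw [← Real.exp_nat_mul, ← Real.exp_add, hl]
          congr 1
          field_simp
          ring

/-- Two-sided Bernstein inequality for an empirical mean. -/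
lemma iid_two_sided_tail (p : PMF α) (X : α → ℝ) {B v b : ℝ} (hB : ∀ x, |X x| ≤ B)
    (hv : expect p (fun x => X x ^ 2) ≤ v) (hv0 : 0 < v) (hb : 0 < b) (hbB : b * B ≤ 2 * v)
    {N : ℕ} (hN : 0 < N) :
    (iid p N).toOuterMeasure {D | b < |1 / (N : ℝ) * ∑ n, X (D n) - expect p X|} ≤
      ENNReal.ofReal (2 * Real.exp (-(N * b ^ 2 / (4 * v)))) := by
  have hN' : (0 : ℝ) < N := by exact_mod_cast hN
  have h1 := iid_upper_tail p X hB hv hv0 hb hbB N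
  have h2 := iid_upper_tail p (fun x => -X x) (by simpa using hB) (by simpa using hv) hv0 hb hbB N
  have hneg : expect p (fun x => -X x) = -expect p X := by
    simpa using expect_mul_left p (-1) X
  rw [hneg] at h2
  have hsub : {D : Fin N → α | b < |1 / (N : ℝ) * ∑ n, X (D n) - expect p X|} ⊆
      {D | N * (expect p X + b) ≤ ∑ n, X (D n)} ∪ {D | N * (-expect p X + b) ≤ ∑ n, -X (D n)} := by
    intro D hD
    simp only [Set.mem_ofPred_eq, Set.mem_union, Finset.sum_neg_distrib] at hD ⊢
    have hs : ∑ n, X (D n) = N * (1 / (N : ℝ) * ∑ n, X (D n)) := by field_simp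
    rw [hs]
    rcases lt_abs.1 hD with h | h
    · exact Or.inl (mul_le_mul_of_nonneg_left (by linarith) hN'.le)
    · rw [← mul_neg]
      exact Or.inr (mul_le_mul_of_nonneg_left (by linarith) hN'.le)
  refine (MeasureTheory.measure_mono hsub).trans ((MeasureTheory.measure_union_le _ _).trans ?_)
  rw [two_mul, ENNReal.ofReal_add (Real.exp_pos _).le (Real.exp_pos _).le]
  exact add_le_add h1 h2

end Concentration

variable {d S A H : ℕ}

/-! ### State-action values and expectations along an episode -/

/-- The behaviour obtained by dropping the first layer. -/
abbrev RandPolicy.tail {n : ℕ} (κ : RandPolicy d S A (n + 1)) : RandPolicy d S A n :=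
  fun i => κ i.succ

namespace MDP

variable (M : MDP d S A)

lemma expect_rollout_succ {n : ℕ} (κ : RandPolicy d S A (n + 1)) (s : State d S)
    (F : (Fin (n + 1) → State d S × Fin A) → ℝ) :
    expect (M.rollout (n + 1) κ s) F = expect (κ 0 s) fun a => expect (M.T s a) fun s' =>
      expect (M.rollout n κ.tail s') fun w =>
        F (Fin.cons (s, a) w : Fin (n + 1) → State d S × Fin A) := by
  simp only [rollout, expect_bind, expect_map]

/-- The expected total reward of `κ` from the state `s` at the first layer. -/
def val {n : ℕ} (κ : RandPolicy d S A n) (s : State d S) : ℝ :=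
  expect (M.rollout n κ s) fun w => ∑ h, M.R (w h).1 (w h).2

/-- `M.qval n κ t s a` is the expected reward collected in the layers `≥ t` when the state-action
pair at layer `t` is `(s, a)` and `κ` is followed afterwards. -/
def qval : (n : ℕ) → RandPolicy d S A n → Fin n → State d S → Fin A → ℝ
  | 0, _ => Fin.elim0
  | n + 1, κ => Fin.cases (fun s a => M.R s a + expect (M.T s a) (M.val κ.tail))
      (qval n κ.tail)

lemma qval_zero {n : ℕ} (κ : RandPolicy d S A (n + 1)) (s : State d S) (a : Fin A) :
    M.qval (n + 1) κ 0 s a = M.R s a + expect (M.T s a) (M.val κ.tail) := rfl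

lemma qval_succ {n : ℕ} (κ : RandPolicy d S A (n + 1)) (t : Fin n) :
    M.qval (n + 1) κ t.succ = M.qval n κ.tail t := rfl

lemma val_succ {n : ℕ} (κ : RandPolicy d S A (n + 1)) (s : State d S) :
    M.val κ s = expect (κ 0 s) (M.qval (n + 1) κ 0 s) := by
  simp only [val, expect_rollout_succ, Fin.sum_univ_succ, Fin.cons_zero, Fin.cons_succ, expect_add,
    expect_const]
  rw [← expect_add]
  rfl

lemma sum_le_succ {n : ℕ} (t : Fin n) (f : Fin (n + 1) → ℝ) :
    ∑ h with t.succ ≤ h, f h = ∑ h with t ≤ h, f h.succ := by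
  simp only [Finset.sum_filter, Fin.sum_univ_succ, Fin.succ_le_succ_iff]
  simp

/-- Conditioning on the state at layer `t`: the weighted reward-to-go is an average of values. -/
lemma expect_rollout_mul_sum (g : State d S → Fin A → ℝ) :
    ∀ (n : ℕ) (κ : RandPolicy d S A n) (t : Fin n) (s : State d S),
      (expect (M.rollout n κ s) fun w =>
        g (w t).1 (w t).2 * ∑ h with t ≤ h, M.R (w h).1 (w h).2) =
      expect (M.rollout n κ s) fun w =>
        expect (κ t (w t).1) fun a => g (w t).1 a * M.qval n κ t (w t).1 a
  | 0, _, t, _ => t.elim0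
  | n + 1, κ, t, s => by
    refine Fin.cases ?_ (fun t => ?_) t
    · simp only [expect_rollout_succ, Fin.cons_zero, Fin.zero_le, Finset.filter_true,
        Fin.sum_univ_succ, Fin.cons_succ, expect_mul_left, expect_add, expect_const, qval_zero]
      rfl
    · simp only [expect_rollout_succ, sum_le_succ, Fin.cons_succ, qval_succ]
      simp only [expect_rollout_mul_sum g n κ.tail t]

/-- The action at layer `t` has law `κ t` given the state at that layer. -/
lemma expect_rollout_stateAction (g : State d S → Fin A → ℝ) :
    ∀ (n : ℕ) (κ : RandPolicy d S A n) (t : Fin n) (s : State d S),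
      (expect (M.rollout n κ s) fun w => g (w t).1 (w t).2) =
      expect (M.rollout n κ s) fun w => expect (κ t (w t).1) (g (w t).1)
  | 0, _, t, _ => t.elim0
  | n + 1, κ, t, s => by
    refine Fin.cases ?_ (fun t => ?_) t
    · simp only [expect_rollout_succ, Fin.cons_zero, expect_const]
    · simp only [expect_rollout_succ, Fin.cons_succ]
      simp only [expect_rollout_stateAction g n κ.tail t]

/-- The law of the state at layer `t` depends only on the behaviour at earlier layers. -/
lemma expect_rollout_state_congr (φ : State d S → ℝ) :
    ∀ (n : ℕ) (κ κ' : RandPolicy d S A n) (t : Fin n) (s : State d S), (∀ h < t, κ h = κ' h) →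
      (expect (M.rollout n κ s) fun w => φ (w t).1) =
      expect (M.rollout n κ' s) fun w => φ (w t).1
  | 0, _, _, t, _, _ => t.elim0
  | n + 1, κ, κ', t, s, h => by
    revert h
    refine Fin.cases (fun _ => ?_) (fun t h => ?_) t
    · simp only [expect_rollout_succ, Fin.cons_zero, expect_const]
    · simp only [expect_rollout_succ, Fin.cons_succ, h 0 (Fin.succ_pos t)]
      simp only [expect_rollout_state_congr φ n κ.tail κ'.tail t _
        fun i hi => h i.succ (Fin.succ_lt_succ_iff.2 hi)]

/-- Values at layer `t` depend only on the behaviour at later layers. -/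
lemma qval_congr :
    ∀ (n : ℕ) (κ κ' : RandPolicy d S A n) (t : Fin n), (∀ h, t < h → κ h = κ' h) →
      M.qval n κ t = M.qval n κ' t
  | 0, _, _, t, _ => t.elim0
  | n + 1, κ, κ', t, h => by
    revert h
    refine Fin.cases (fun h => ?_) (fun t h => ?_) t
    · have : κ.tail = κ'.tail := funext fun i => h i.succ (Fin.succ_pos i)
      funext s a
      rw [qval_zero, qval_zero, this]
    · rw [qval_succ, qval_succ]
      exact qval_congr n κ.tail κ'.tail t fun i hi => h i.succ (Fin.succ_lt_succ_iff.2 hi)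

/-- Performance difference lemma, from a fixed initial state. -/
lemma val_sub_val :
    ∀ (n : ℕ) (π' π : Policy d S A n) (s : State d S),
      M.val π'.toRand s - M.val π.toRand s =
        ∑ t, expect (M.rollout n π'.toRand s) fun w =>
          M.qval n π.toRand t (w t).1 (π' t (w t).1) - M.qval n π.toRand t (w t).1 (π t (w t).1)
  | 0, _, _, _ => by simp [val, expect_const]
  | n + 1, π', π, s => by
    have ih := fun s' => val_sub_val n (fun i => π' i.succ) (fun i => π i.succ) s'
    have e : ∀ ρ : Policy d S A (n + 1),
        RandPolicy.tail ρ.toRand = Policy.toRand fun i => ρ i.succ := fun _ => rfl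
    have e0 : ∀ (ρ : Policy d S A (n + 1)), ρ.toRand 0 s = PMF.pure (ρ 0 s) := fun _ => rfl
    simp only [val_succ, Fin.sum_univ_succ, expect_rollout_succ, Fin.cons_zero, Fin.cons_succ,
      qval_succ, e, e0, expect_pure, expect_const]
    rw [← expect_sum]
    simp only [← ih]
    rw [expect_sub, qval_zero, qval_zero, e, e, qval_zero, e]
    ring

end MDP

/-! ### Decoupling of the endogenous and the exogenous factors -/

/-- The state with the given sub-vectors on `I` and on its complement. -/
def glue (I : Finset (Fin d)) (x : ↥I → Fin S) (y : ↥(Iᶜ) → Fin S) : State d S := fun i =>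
  if h : i ∈ I then x ⟨i, h⟩ else y ⟨i, Finset.mem_compl.2 h⟩

variable {I : Finset (Fin d)}

@[simp]
lemma restrict_glue (x : ↥I → Fin S) (y : ↥(Iᶜ) → Fin S) : I.restrict (glue I x y) = x := by
  funext i
  simp [glue]

@[simp]
lemma restrict_compl_glue (x : ↥I → Fin S) (y : ↥(Iᶜ) → Fin S) :
    Iᶜ.restrict (glue I x y) = y := by
  funext i
  simp [glue, Finset.mem_compl.1 i.2]

@[simp]
lemma glue_restrict (s : State d S) : glue I (I.restrict s) (Iᶜ.restrict s) = s := by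
  funext i
  simp [glue]

/-- A law that factorizes over `I` and its complement is the law of two independent sub-vectors. -/
lemma expect_eq_expect_glue {p : PMF (State d S)} {p₁ : PMF (↥I → Fin S)}
    {p₂ : PMF (↥(Iᶜ) → Fin S)} (h : ∀ s, p s = p₁ (I.restrict s) * p₂ (Iᶜ.restrict s))
    (f : State d S → ℝ) :
    expect p f = expect p₁ fun x => expect p₂ fun y => f (glue I x y) := by
  let e : State d S ≃ (↥I → Fin S) × (↥(Iᶜ) → Fin S) :=
    { toFun := fun s => (I.restrict s, Iᶜ.restrict s)
      invFun := fun z => glue I z.1 z.2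
      left_inv := glue_restrict
      right_inv := fun z => by simp }
  simp only [expect, Finset.mul_sum]
  rw [← Fintype.sum_prod_type' (f := fun x y =>
    (p₁ x).toReal * ((p₂ y).toReal * f (glue I x y))), ← e.symm.sum_comp]
  refine Finset.sum_congr rfl fun z _ => ?_
  simp only [h, e, Equiv.coe_fn_symm_mk, restrict_glue, restrict_compl_glue, ENNReal.toReal_mul]
  ring

/-- A randomized behaviour is endogenous if it depends only on the factors in `I`. -/
def EndoRand {n : ℕ} (I : Finset (Fin d)) (κ : RandPolicy d S A n) : Prop :=
  ∀ h s s', I.restrict s = I.restrict s' → κ h s = κ h s'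

lemma Endogenous.endoRand {π : Policy d S A H} (h : Endogenous I π) : EndoRand I π.toRand :=
  fun t s s' hs => congrArg PMF.pure (h t s s' hs)

namespace MDP

variable {M : MDP d S A}

lemma IsExo.expect_T_congr (hM : M.IsExo I) {f : State d S → ℝ}
    (hf : ∀ s s', I.restrict s = I.restrict s' → f s = f s') {s s' : State d S}
    (h : I.restrict s = I.restrict s') (a : Fin A) : expect (M.T s a) f = expect (M.T s' a) f := by
  obtain ⟨Ten, Tex, _, _, _, hT, _, _⟩ := hM
  have key : ∀ s₀, expect (M.T s₀ a) f =
      expect (Ten (I.restrict s₀) a) fun x => f (glue I x (Iᶜ.restrict s)) := fun s₀ => by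
    rw [expect_eq_expect_glue (hT s₀ a)]
    congr 1
    funext x
    rw [← expect_const (Tex (Iᶜ.restrict s₀)) (f (glue I x (Iᶜ.restrict s)))]
    congr 1
    funext y
    exact hf _ _ (by simp)
  rw [key, key, h]

lemma IsExo.R_congr (hM : M.IsExo I) {s s' : State d S} (h : I.restrict s = I.restrict s')
    (a : Fin A) : M.R s a = M.R s' a := by
  obtain ⟨_, _, Ren, _, _, _, hR, _⟩ := hM
  rw [hR, hR, h]

lemma IsExo.val_congr (hM : M.IsExo I) :
    ∀ (n : ℕ) (κ : RandPolicy d S A n), EndoRand I κ → ∀ s s', I.restrict s = I.restrict s' →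
      M.val κ s = M.val κ s'
  | 0, _, _, _, _, _ => by simp [val, expect_const]
  | n + 1, κ, hκ, s, s', h => by
    rw [val_succ, val_succ, hκ 0 s s' h]
    congr 1
    funext a
    rw [qval_zero, qval_zero, hM.R_congr h,
      hM.expect_T_congr (hM.val_congr n κ.tail fun i => hκ i.succ) h]

/-- The values of an endogenous behaviour depend only on the endogenous part of the state. -/
lemma IsExo.qval_congr_state (hM : M.IsExo I) :
    ∀ (n : ℕ) (κ : RandPolicy d S A n) (t : Fin n), EndoRand I κ →
      ∀ s s', I.restrict s = I.restrict s' → M.qval n κ t s = M.qval n κ t s'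
  | 0, _, t, _, _, _, _ => t.elim0
  | n + 1, κ, t, hκ, s, s', h => by
    have hκ' : EndoRand I κ.tail := fun i => hκ i.succ
    refine Fin.cases ?_ (fun t => ?_) t
    · funext a
      rw [qval_zero, qval_zero, hM.R_congr h, hM.expect_T_congr (hM.val_congr n κ.tail hκ') h]
    · rw [qval_succ]
      exact hM.qval_congr_state n κ.tail t hκ' s s' h

lemma expect_episode (κ : RandPolicy d S A H) (F : (Fin H → State d S × Fin A) → ℝ) :
    expect (M.episode κ) F = expect M.d₁ fun s => expect (M.rollout H κ s) F :=
  expect_bind _ _ _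

/-- Under an endogenous behaviour started from independent endogenous and exogenous parts, the two
parts of the state at layer `t` are independent, and the law `qex` of the exogenous part does not
depend on the behaviour. -/
lemma exists_expect_rollout_state_eq [NeZero S]
    {Ten : (↥I → Fin S) → Fin A → PMF (↥I → Fin S)}
    {Tex : (↥(Iᶜ) → Fin S) → PMF (↥(Iᶜ) → Fin S)}
    (hT : ∀ s a s', M.T s a s' =
      Ten (I.restrict s) a (I.restrict s') * Tex (Iᶜ.restrict s) (Iᶜ.restrict s')) :
    ∀ (n : ℕ) (t : Fin n) (qex₀ : PMF (↥(Iᶜ) → Fin S)), ∃ qex : PMF (↥(Iᶜ) → Fin S),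
      ∀ κ : RandPolicy d S A n, EndoRand I κ → ∀ qen₀ : PMF (↥I → Fin S),
      ∃ qen : PMF (↥I → Fin S), ∀ φ : State d S → ℝ,
        (expect qen₀ fun x => expect qex₀ fun y => expect (M.rollout n κ (glue I x y)) fun w =>
          φ (w t).1) = expect qen fun x => expect qex fun y => φ (glue I x y)
  | 0, t, _ => t.elim0
  | n + 1, t, qex₀ => by
    refine Fin.cases ?_ (fun t => ?_) t
    · exact ⟨qex₀, fun κ _ qen₀ => ⟨qen₀, fun φ => by
        simp only [expect_rollout_succ, Fin.cons_zero, expect_const]⟩⟩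
    · obtain ⟨qex, hq⟩ := exists_expect_rollout_state_eq hT n t (qex₀.bind Tex)
      refine ⟨qex, fun κ hκ qen₀ => ?_⟩
      obtain ⟨qen, h⟩ := hq κ.tail (fun i => hκ i.succ)
        (qen₀.bind fun x => (κ 0 (glue I x 0)).bind (Ten x))
      refine ⟨qen, fun φ => ?_⟩
      have h0 : ∀ x y, κ 0 (glue I x y) = κ 0 (glue I x 0) := fun x y => hκ 0 _ _ (by simp)
      rw [← h]
      simp only [expect_bind, expect_rollout_succ, Fin.cons_succ, h0,
        fun s a => expect_eq_expect_glue (hT s a), restrict_glue, restrict_compl_glue]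
      congr 1
      funext x
      rw [expect_comm]
      congr 1
      funext a
      rw [expect_comm]

/-- The average over `ψ ∈ Ψ` of the expected reward collected in the layers `≥ t` when `ψ` is
followed before layer `t`, the one-step policy `σ` is used at layer `t`, and `π` is followed
afterwards. -/
def layerValue (M : MDP d S A) (t : Fin H) (Ψ : Finset (Policy d S A H)) (π : Policy d S A H)
    (σ : OneStep d S A) : ℝ :=
  (Ψ.card : ℝ)⁻¹ * ∑ ψ ∈ Ψ, expect (M.episode ψ.toRand) fun w =>
    M.qval H π.toRand t (w t).1 (σ (w t).1)

/-- The restriction property: with endogenous roll-in and roll-out, a one-step policy acting on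
`J` is no better than some one-step policy acting on the endogenous factors in `J` only. The latter
is obtained by freezing the exogenous part of the state at its best value. -/
lemma IsExo.exists_actsOn_inter_le [NeZero S] (hM : M.IsExo I) {Ψ : Finset (Policy d S A H)}
    (hΨ : ∀ ψ ∈ Ψ, Endogenous I ψ) {π : Policy d S A H} (hπ : Endogenous I π) (t : Fin H)
    {J : Finset (Fin d)} {σ : OneStep d S A} (hσ : ActsOn J σ) :
    ∃ σ', ActsOn (J ∩ I) σ' ∧ M.layerValue t Ψ π σ ≤ M.layerValue t Ψ π σ' := by
  have hM' := hM
  obtain ⟨Ten, Tex, _, den, dex, hT, _, hd⟩ := hM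
  obtain ⟨qex, hq⟩ := exists_expect_rollout_state_eq hT H t dex
  have hq' : ∀ ψ ∈ Ψ, ∃ qen : PMF (↥I → Fin S), ∀ φ : State d S → ℝ,
      (expect (M.episode ψ.toRand) fun w => φ (w t).1) =
        expect qen fun x => expect qex fun y => φ (glue I x y) := fun ψ hψ => by
    obtain ⟨qen, h⟩ := hq ψ.toRand (hΨ ψ hψ).endoRand den
    exact ⟨qen, fun φ => by rw [expect_episode, expect_eq_expect_glue hd, h]⟩
  choose! qen hqen using hq'
  have hval : ∀ σ : OneStep d S A, M.layerValue t Ψ π σ = expect qex fun y =>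
      (Ψ.card : ℝ)⁻¹ * ∑ ψ ∈ Ψ, expect (qen ψ) fun x =>
        M.qval H π.toRand t (glue I x 0) (σ (glue I x y)) := fun σ => by
    rw [expect_mul_left, expect_sum, layerValue]
    congr 1
    refine Finset.sum_congr rfl fun ψ hψ => ?_
    rw [hqen ψ hψ fun s => M.qval H π.toRand t s (σ s), expect_comm]
    congr 1
    funext y
    congr 1
    funext x
    rw [hM'.qval_congr_state H π.toRand t hπ.endoRand (glue I x y) (glue I x 0) (by simp)]
  obtain ⟨y, hy⟩ := exists_expect_le qex fun y =>
      (Ψ.card : ℝ)⁻¹ * ∑ ψ ∈ Ψ, expect (qen ψ) fun x =>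
        M.qval H π.toRand t (glue I x 0) (σ (glue I x y))
  refine ⟨fun s => σ (glue I (I.restrict s) y), fun s s' h => hσ _ _ ?_, ?_⟩
  · funext i
    by_cases hi : i.1 ∈ I
    · have := congrFun h ⟨i, Finset.mem_inter.2 ⟨i.2, hi⟩⟩
      simpa [glue, hi] using this
    · simp [glue, hi]
  · rw [hval, hval fun s => σ (glue I (I.restrict s) y)]
    simp only [restrict_glue, expect_const]
    exact hy

/-- Layer values depend only on the layers of the roll-out policy after `t`. -/
lemma layerValue_congr (t : Fin H) (Ψ : Finset (Policy d S A H)) {π π' : Policy d S A H}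
    (h : ∀ i, t < i → π i = π' i) : M.layerValue t Ψ π = M.layerValue t Ψ π' := by
  funext σ
  rw [layerValue, layerValue, qval_congr M H π.toRand π'.toRand t fun i hi => by
    funext s
    simp only [Policy.toRand, h i hi]]

/-! ### From near-optimality at each layer to near-optimality -/

/-- Performance difference lemma. -/
lemma J_sub_J (π' π : Policy d S A H) : M.J π' - M.J π =
    ∑ t, expect (M.episode π'.toRand) fun w =>
      M.qval H π.toRand t (w t).1 (π' t (w t).1) - M.qval H π.toRand t (w t).1 (π t (w t).1) := by
  have hJ : ∀ ρ : Policy d S A H, M.J ρ = expect M.d₁ (M.val ρ.toRand) := fun ρ =>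
    expect_episode _ _
  simp only [hJ, ← expect_sub, val_sub_val, expect_sum, expect_episode]

/-- The expectation of a function of the endogenous state is a sum against occupancies. -/
lemma expect_episode_eq_sum_occ [NeZero S] (π : Policy d S A H) (t : Fin H) (g : State d S → ℝ)
    (hg : ∀ s s', I.restrict s = I.restrict s' → g s = g s') :
    (expect (M.episode π.toRand) fun w => g (w t).1) =
      ∑ x : ↥I → Fin S, g (glue I x 0) * M.occ π t I (glue I x 0) := by
  classical
  simp only [occ, toReal_toOuterMeasure, ← expect_mul_left]
  rw [← expect_sum]
  congr 1
  funext w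
  rw [Finset.sum_eq_single (I.restrict (w t).1)]
  · simpa using hg _ _ (by simp)
  · intro x _ hx
    simp [Ne.symm hx]
  · simp

/-- Under reachability, an approximate cover loses at most a factor two in each occupancy. -/
lemma IsEndoCover.exists_occ_le {η : ℝ} (hreach : M.Reachable H I η) {t : Fin H}
    {Ψ : Finset (Policy d S A H)} (hΨ : M.IsEndoCover I (η / 2) t Ψ) (s : State d S) :
    ∃ ψ ∈ Ψ, ∀ π : Policy d S A H, M.occ π t I s ≤ 2 * M.occ ψ t I s := by
  obtain ⟨ψ, hψ, h⟩ := hΨ.1 s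
  refine ⟨ψ, hψ, fun π => ?_⟩
  rcases hreach t s with ⟨π₀, h₀⟩ | h₀
  · have := h π₀
    have := h π
    linarith
  · simp [h₀]

/-- Transfer of a small average loss under the cover to every policy. -/
lemma IsEndoCover.expect_le [NeZero S] {η : ℝ} (hreach : M.Reachable H I η)
    {t : Fin H} {Ψ : Finset (Policy d S A H)} (hΨ : M.IsEndoCover I (η / 2) t Ψ)
    (π : Policy d S A H) {g : State d S → ℝ} (hg0 : ∀ s, 0 ≤ g s)
    (hg : ∀ s s', I.restrict s = I.restrict s' → g s = g s') :
    (expect (M.episode π.toRand) fun w => g (w t).1) ≤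
      2 * ∑ ψ ∈ Ψ, expect (M.episode ψ.toRand) fun w => g (w t).1 := by
  simp only [expect_episode_eq_sum_occ _ t g hg]
  rw [Finset.sum_comm, Finset.mul_sum]
  refine Finset.sum_le_sum fun x _ => ?_
  obtain ⟨ψ, hψ, h⟩ := hΨ.exists_occ_le hreach (glue I x 0)
  have h1 : M.occ ψ t I (glue I x 0) ≤ ∑ ψ ∈ Ψ, M.occ ψ t I (glue I x 0) :=
    Finset.single_le_sum (f := fun ψ => M.occ ψ t I (glue I x 0))
      (fun _ _ => ENNReal.toReal_nonneg) hψ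
  rw [← Finset.mul_sum]
  nlinarith [h π, hg0 (glue I x 0)]

/-- If at every layer the one-step policy of an endogenous `π` is `e`-optimal for the layer value
among endogenous one-step policies, then `π` is `2 e ∑ t, |Ψ t|`-optimal. -/
lemma IsExo.J_le_of_layerValue_le [NeZero S] [NeZero A] (hM : M.IsExo I) {η : ℝ}
    (hreach : M.Reachable H I η) {Ψ : Fin H → Finset (Policy d S A H)}
    (hne : ∀ t, (Ψ t).Nonempty) (hΨ : ∀ t, M.IsEndoCover I (η / 2) t (Ψ t))
    {π : Policy d S A H} (hπ : Endogenous I π) {e : ℝ}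
    (hopt : ∀ t σ, ActsOn I σ → M.layerValue t (Ψ t) π σ ≤ M.layerValue t (Ψ t) π (π t) + e)
    (π' : Policy d S A H) : M.J π' ≤ M.J π + ∑ t, 2 * (Ψ t).card * e := by
  rw [← sub_le_iff_le_add', J_sub_J]
  refine Finset.sum_le_sum fun t _ => ?_
  set q := M.qval H π.toRand t with hq
  have hqc : ∀ s s', I.restrict s = I.restrict s' → q s = q s' :=
    hM.qval_congr_state H π.toRand t hπ.endoRand
  -- the greedy one-step policy, defined through `q s` only, so that it is endogenous
  have hex : ∀ f : Fin A → ℝ, ∃ a, ∀ b, f b ≤ f a := fun f => Finite.exists_max f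
  choose m hm using hex
  have hσ : ActsOn I fun s => m (q s) := fun s s' h => by simp only [hqc s s' h]
  set g : State d S → ℝ := fun s => q s (m (q s)) - q s (π t s) with hg
  have hg0 : ∀ s, 0 ≤ g s := fun s => sub_nonneg.2 (hm _ _)
  have hgc : ∀ s s', I.restrict s = I.restrict s' → g s = g s' := fun s s' h => by
    simp only [hg, hqc s s' h, hπ t s s' h]
  have hcard : (0 : ℝ) < (Ψ t).card := by exact_mod_cast (hne t).card_pos
  have hloss : ∑ ψ ∈ Ψ t, expect (M.episode ψ.toRand) (fun w => g (w t).1) ≤ (Ψ t).card * e := by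
    have := hopt t _ hσ
    rw [← sub_le_iff_le_add', layerValue, layerValue, ← mul_sub, ← Finset.sum_sub_distrib,
      inv_mul_le_iff₀ hcard] at this
    simpa only [hg, expect_sub] using this
  calc _ ≤ expect (M.episode π'.toRand) fun w => g (w t).1 :=
        expect_mono _ fun w => sub_le_sub_right (hm _ _) _
    _ ≤ 2 * ∑ ψ ∈ Ψ t, expect (M.episode ψ.toRand) fun w => g (w t).1 :=
        (hΨ t).expect_le hreach π' hg0 hgc
    _ ≤ 2 * ((Ψ t).card * e) := by gcongr
    _ = _ := by ring

end MDP

/-! ### Correctness of EndoPolicyOptimization -/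

/-- If `V` approximates `v` up to `b ≤ ε / (2 k)` and `v` has the restriction property with respect
to `I`, then EndoPolicyOptimization returns a policy acting on `I` that is `4 ε`-optimal for `v`
among such policies. Were the selected set `J` not contained in `I`, the smaller set `J ∩ I` would
have passed its test, whose slack is larger by at least `ε / k`. -/
lemma IsEPOOutput.exists_eq_some {k : ℕ} (hk : 1 ≤ k) (hI : I.card ≤ k) {ε b : ℝ} (hε : 0 < ε)
    (hb : 2 * b ≤ ε / k) {v V : OneStep d S A → ℝ}
    (hv : ∀ (J : Finset (Fin d)) (σ : OneStep d S A), ActsOn J σ →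
      ∃ σ', ActsOn (J ∩ I) σ' ∧ v σ ≤ v σ')
    (hV : ∀ σ : OneStep d S A, (∃ J : Finset (Fin d), J.card ≤ k ∧ ActsOn J σ) → |V σ - v σ| ≤ b)
    {out : Option (OneStep d S A)} (hout : IsEPOOutput k ε V out) :
    ∃ σ, out = some σ ∧ ActsOn I σ ∧ ∀ σ', ActsOn I σ' → v σ' ≤ v σ + 4 * ε := by
  have hk' : (1 : ℝ) ≤ k := by exact_mod_cast hk
  have hbase : (1 : ℝ) ≤ 1 + 1 / k := le_add_of_nonneg_right (by positivity)
  have hεk : ε / k ≤ ε := div_le_self hε.le hk'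
  have hinter : ∀ {J : Finset (Fin d)}, J.card ≤ k → (J ∩ I).card ≤ k := fun hJ =>
    (Finset.card_le_card Finset.inter_subset_left).trans hJ
  match out, hout with
  | none, hout =>
    refine absurd ?_ (hout I hI)
    rintro σ ⟨J, hJ, hσ⟩
    obtain ⟨σ', hσ', hle⟩ := hv J σ hσ
    have hσ'I : ActsOn I σ' := fun s s' h => hσ' s s' <| funext fun i =>
      congrFun h ⟨i, (Finset.mem_inter.1 i.2).2⟩
    refine ⟨σ', hσ'I, ?_⟩
    have h1 := abs_le.1 (hV σ ⟨J, hJ, hσ⟩)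
    have h2 := abs_le.1 (hV σ' ⟨I, hI, hσ'I⟩)
    have h3 : ε ≤ (1 + 1 / (k : ℝ)) ^ (k - I.card) * ε :=
      le_mul_of_one_le_left hε.le (one_le_pow₀ hbase)
    linarith
  | some σ, ⟨J, hJ, hcov, hmin, hσ, hmax⟩ =>
    have hJI : J ⊆ I := by
      by_contra hJI
      have hlt : (J ∩ I).card < J.card := Finset.card_lt_card
        ⟨Finset.inter_subset_left, fun h => hJI fun i hi => (Finset.mem_inter.1 (h hi)).2⟩
      refine hmin (J ∩ I) hlt fun ρ hρ => ?_
      obtain ⟨ρ₁, hρ₁, hle₁⟩ := hcov ρ hρ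
      obtain ⟨ρ₂, hρ₂, hle₂⟩ := hv J ρ₁ hρ₁
      refine ⟨ρ₂, hρ₂, ?_⟩
      have h1 := abs_le.1 (hV ρ₁ ⟨J, hJ, hρ₁⟩)
      have h2 := abs_le.1 (hV ρ₂ ⟨J ∩ I, hinter hJ, hρ₂⟩)
      have h3 : (1 + 1 / (k : ℝ)) ^ (k - J.card) * ε + ε / k ≤
          (1 + 1 / (k : ℝ)) ^ (k - (J ∩ I).card) * ε := by
        have h4 : (1 + 1 / (k : ℝ)) ^ (k - J.card + 1) ≤
            (1 + 1 / (k : ℝ)) ^ (k - (J ∩ I).card) := pow_le_pow_right₀ hbase (by omega)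
        have h5 : (1 : ℝ) ≤ (1 + 1 / (k : ℝ)) ^ (k - J.card) := one_le_pow₀ hbase
        calc _ ≤ (1 + 1 / (k : ℝ)) ^ (k - J.card) * ε +
              (1 + 1 / (k : ℝ)) ^ (k - J.card) * (ε / k) := by
              gcongr
              exact le_mul_of_one_le_left (by positivity) h5
          _ = (1 + 1 / (k : ℝ)) ^ (k - J.card + 1) * ε := by ring
          _ ≤ _ := by gcongr
      linarith
    refine ⟨σ, rfl, fun s s' h => hσ s s' <| funext fun i => congrFun h ⟨i, hJI i.2⟩,
      fun σ' hσ' => ?_⟩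
    obtain ⟨ρ, hρ, hle⟩ := hcov σ' ⟨I, hI, hσ'⟩
    have h1 := abs_le.1 (hV σ' ⟨I, hI, hσ'⟩)
    have h2 := abs_le.1 (hV σ ⟨J, hJ, hσ⟩)
    have h3 : (1 + 1 / (k : ℝ)) ^ (k - J.card) ≤ 3 := by
      calc (1 + 1 / (k : ℝ)) ^ (k - J.card) ≤ (1 + 1 / (k : ℝ)) ^ k :=
            pow_le_pow_right₀ hbase (Nat.sub_le _ _)
        _ ≤ Real.exp (1 / k) ^ k := by
            gcongr
            rw [add_comm]
            exact Real.add_one_le_exp _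
        _ = Real.exp 1 := by
            rw [← Real.exp_nat_mul]
            congr 1
            field_simp
        _ ≤ 3 := Real.exp_one_lt_three.le
    have h4 : (1 + 1 / (k : ℝ)) ^ (k - J.card) * ε ≤ 3 * ε := by gcongr
    linarith [hmax ρ hρ]

/-! ### Concentration of the importance-weighted estimates -/

/-- Policies acting on at most `k` factors are described by a choice of `k` factors and a table. -/
lemma exists_eq_comp_of_actsOn [NeZero S] [NeZero A] {k : ℕ} (hd : 1 ≤ d)
    {σ : OneStep d S A} {J : Finset (Fin d)} (hJ : J.card ≤ k) (hσ : ActsOn J σ) :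
    ∃ (c : Fin k → Fin d) (g : (Fin k → Fin S) → Fin A), σ = fun s => g fun i => s (c i) := by
  have : ∃ c : Fin k → Fin d, ∀ j ∈ J, ∃ i, c i = j := by
    have : Nonempty (Fin d) := ⟨⟨0, hd⟩⟩
    let e : ↥J ↪ Fin k := (J.equivFin.toEmbedding).trans (Fin.castLEEmb hJ)
    refine ⟨fun i => if h : ∃ j, e j = i then (h.choose : Fin d) else Classical.arbitrary _,
      fun j hj => ⟨e ⟨j, hj⟩, ?_⟩⟩
    have h : ∃ j', e j' = e ⟨j, hj⟩ := ⟨_, rfl⟩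
    simp only [dif_pos h, e.injective h.choose_spec]
  obtain ⟨c, hc⟩ := this
  let f : State d S → Fin k → Fin S := fun s i => s (c i)
  have hf : Function.FactorsThrough σ f := fun s s' h => hσ s s' <| funext fun j => by
    obtain ⟨i, hi⟩ := hc j j.2
    have := congrFun h i
    simpa [f, hi] using this
  exact ⟨c, Function.extend f σ fun _ => 0, funext fun s => (hf.extend_apply _ s).symm⟩

/-- The importance-weighted reward-to-go of a state-action sequence. -/
def weightedReturn (M : MDP d S A) (t : Fin H) (σ : OneStep d S A)
    (w : Fin H → State d S × Fin A) : ℝ :=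
  (if (w t).2 = σ (w t).1 then (1 : ℝ) else 0) / (1 / (A : ℝ)) *
    ∑ h with t ≤ h, M.R (w h).1 (w h).2

/-- The law of the state-action sequence of a trajectory collected at layer `t`. -/
def exploreLaw [NeZero A] (M : MDP d S A) (t : Fin H) (Ψ : Finset (Policy d S A H))
    (hΨ : Ψ.Nonempty) (π : Policy d S A H) : PMF (Fin H → State d S × Fin A) :=
  (PMF.uniformOfFinset Ψ hΨ).bind fun ψ => M.episode (explore t ψ π)

namespace MDP

variable {M : MDP d S A}

lemma sum_reward_mem (t : Fin H) (w : Fin H → State d S × Fin A) :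
    ∑ h with t ≤ h, M.R (w h).1 (w h).2 ∈ Set.Icc (0 : ℝ) H := by
  refine ⟨Finset.sum_nonneg fun h _ => (M.R_mem _ _).1, ?_⟩
  calc ∑ h with t ≤ h, M.R (w h).1 (w h).2 ≤ ∑ h : Fin H, (1 : ℝ) :=
        (Finset.sum_le_sum fun h _ => (M.R_mem _ _).2).trans
          (Finset.sum_le_sum_of_subset_of_nonneg (Finset.filter_subset _ _) fun _ _ _ => zero_le_one)
    _ = H := by simp

lemma abs_weightedReturn_le (t : Fin H) (σ : OneStep d S A) (w : Fin H → State d S × Fin A) :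
    |weightedReturn M t σ w| ≤ A * H := by
  obtain ⟨h0, h1⟩ := M.sum_reward_mem t w
  rw [weightedReturn, abs_mul, abs_of_nonneg h0]
  gcongr
  split_ifs <;> simp

section

variable [NeZero A]

lemma explore_self (t : Fin H) (ψ π : Policy d S A H) (s : State d S) :
    explore t ψ π t s = PMF.uniformOfFintype (Fin A) := by
  simp [explore]

lemma expect_uniform_ite (a : Fin A) (q : Fin A → ℝ) :
    (expect (PMF.uniformOfFintype (Fin A)) fun b =>
      (if b = a then (1 : ℝ) else 0) / (1 / (A : ℝ)) * q b) = q a := by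
  have hA : (A : ℝ) ≠ 0 := Nat.cast_ne_zero.2 (NeZero.ne A)
  rw [expect_uniformOfFintype, Fintype.card_fin, Finset.sum_eq_single a]
  · simp only [if_true]
    field_simp
  · intro b _ hb
    simp [hb]
  · simp

/-- The importance-weighted estimate is unbiased. -/
lemma expect_weightedReturn (t : Fin H) (Ψ : Finset (Policy d S A H)) (hΨ : Ψ.Nonempty)
    (π : Policy d S A H) (σ : OneStep d S A) :
    expect (exploreLaw M t Ψ hΨ π) (weightedReturn M t σ) = M.layerValue t Ψ π σ := by
  rw [exploreLaw, expect_bind, expect_uniformOfFinset, layerValue]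
  congr 1
  refine Finset.sum_congr rfl fun ψ _ => ?_
  rw [expect_episode, expect_episode]
  congr 1
  funext s
  have hq : M.qval H (explore t ψ π) t = M.qval H π.toRand t := qval_congr M H _ _ t fun i hi => by
    funext s
    simp [explore, Policy.toRand, hi.not_gt, hi.ne']
  have h := M.expect_rollout_mul_sum
    (fun s a => (if a = σ s then (1 : ℝ) else 0) / (1 / (A : ℝ))) H (explore t ψ π) t s
  simp only [explore_self, expect_uniform_ite, hq] at h
  refine h.trans (M.expect_rollout_state_congr (fun s => M.qval H π.toRand t s (σ s)) H _ _ t s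
    fun i hi => ?_)
  funext s
  simp [explore, Policy.toRand, hi]

/-- The second moment has a factor `A` and not `A ^ 2`, since the weight is nonzero with
probability `1 / A`. -/
lemma expect_weightedReturn_sq_le (t : Fin H) (Ψ : Finset (Policy d S A H)) (hΨ : Ψ.Nonempty)
    (π : Policy d S A H) (σ : OneStep d S A) :
    expect (exploreLaw M t Ψ hΨ π) (fun w => weightedReturn M t σ w ^ 2) ≤ A * (H : ℝ) ^ 2 := by
  have h1 : ∀ w, weightedReturn M t σ w ^ 2 ≤
      (if (w t).2 = σ (w t).1 then (1 : ℝ) else 0) / (1 / (A : ℝ)) * (A * (H : ℝ) ^ 2) := fun w => by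
    obtain ⟨h0, h1⟩ := M.sum_reward_mem t w
    rw [weightedReturn]
    split_ifs
    · rw [mul_pow]
      calc _ ≤ (1 / (1 / (A : ℝ))) ^ 2 * (H : ℝ) ^ 2 := by gcongr
        _ = _ := by simp only [one_div_one_div]; ring
    · simp
  refine (expect_mono _ h1).trans (le_of_eq ?_)
  have h2 : ∀ ψ : Policy d S A H, (expect (M.episode (explore t ψ π)) fun w =>
      (if (w t).2 = σ (w t).1 then (1 : ℝ) else 0) / (1 / (A : ℝ)) * (A * (H : ℝ) ^ 2)) =
      A * (H : ℝ) ^ 2 := fun ψ => by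
    rw [expect_episode]
    simp only [M.expect_rollout_stateAction (fun s a =>
      (if a = σ s then (1 : ℝ) else 0) / (1 / (A : ℝ)) * (A * (H : ℝ) ^ 2)), explore_self,
      expect_uniform_ite _ fun _ => A * (H : ℝ) ^ 2, expect_const]
  rw [exploreLaw, expect_bind]
  simp only [h2, expect_const]

lemma iid_trajLaw (t : Fin H) (Ψ : Finset (Policy d S A H)) (hΨ : Ψ.Nonempty)
    (π : Policy d S A H) (N : ℕ) : iid (M.trajLaw t Ψ hΨ π) N =
      (iid (exploreLaw M t Ψ hΨ π) N).map
        fun D n h => ((D n h).1, (D n h).2, M.R (D n h).1 (D n h).2) := by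
  rw [trajLaw, ← PMF.map_bind, ← exploreLaw, iid_map]

/-- Uniform concentration of the estimates over the policies acting on at most `k` factors. -/
lemma estimates_tail [NeZero S] {k : ℕ} (hd : 1 ≤ d) (hH : 1 ≤ H) (t : Fin H)
    (Ψ : Finset (Policy d S A H)) (hΨ : Ψ.Nonempty) (π : Policy d S A H) {b : ℝ} (hb : 0 < b)
    (hb1 : b ≤ 1) {N : ℕ} (hN : 0 < N) :
    (iid (M.trajLaw t Ψ hΨ π) N).toOuterMeasure {D | ∃ σ : OneStep d S A,
        (∃ J : Finset (Fin d), J.card ≤ k ∧ ActsOn J σ) ∧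
          b < |Vhat t D σ - M.layerValue t Ψ π σ|} ≤
      ENNReal.ofReal ((d : ℝ) ^ k * (A : ℝ) ^ S ^ k *
        (2 * Real.exp (-(N * b ^ 2 / (4 * (A * (H : ℝ) ^ 2)))))) := by
  have hA : (0 : ℝ) < A := by exact_mod_cast Nat.pos_of_ne_zero (NeZero.ne A)
  have hH' : (1 : ℝ) ≤ H := by exact_mod_cast hH
  set p := exploreLaw M t Ψ hΨ π with hp
  let pol : (Fin k → Fin d) × ((Fin k → Fin S) → Fin A) → OneStep d S A :=
    fun z s => z.2 fun i => s (z.1 i)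
  rw [iid_trajLaw, PMF.toOuterMeasure_map_apply]
  have hsub : (fun (D : Fin N → Fin H → State d S × Fin A) n h =>
        ((D n h).1, (D n h).2, M.R (D n h).1 (D n h).2)) ⁻¹' {D | ∃ σ : OneStep d S A,
        (∃ J : Finset (Fin d), J.card ≤ k ∧ ActsOn J σ) ∧
          b < |Vhat t D σ - M.layerValue t Ψ π σ|} ⊆
      ⋃ z, {D | b < |1 / (N : ℝ) * ∑ n, weightedReturn M t (pol z) (D n) -
        expect p (weightedReturn M t (pol z))|} := by
    rintro D ⟨σ, ⟨J, hJ, hσ⟩, hlt⟩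
    obtain ⟨c, g, rfl⟩ := exists_eq_comp_of_actsOn hd hJ hσ
    refine Set.mem_iUnion.2 ⟨(c, g), ?_⟩
    rw [Set.mem_ofPred_eq, hp, expect_weightedReturn]
    exact hlt
  have hone : ∀ z, (iid p N).toOuterMeasure {D | b < |1 / (N : ℝ) *
      ∑ n, weightedReturn M t (pol z) (D n) - expect p (weightedReturn M t (pol z))|} ≤
      ENNReal.ofReal (2 * Real.exp (-(N * b ^ 2 / (4 * (A * (H : ℝ) ^ 2))))) := fun z =>
    iid_two_sided_tail p _ (abs_weightedReturn_le t (pol z))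
      (expect_weightedReturn_sq_le t Ψ hΨ π (pol z)) (by positivity) hb
      (by nlinarith [mul_pos hA (by linarith : (0 : ℝ) < H)]) hN
  refine (MeasureTheory.measure_mono hsub).trans ((MeasureTheory.measure_iUnion_le _).trans ?_)
  rw [tsum_fintype]
  refine (Finset.sum_le_sum fun z _ => hone z).trans (le_of_eq ?_)
  rw [Finset.sum_const, nsmul_eq_mul,
    ENNReal.ofReal_mul (p := (d : ℝ) ^ k * (A : ℝ) ^ S ^ k) (by positivity)]
  congr 1
  rw [← ENNReal.ofReal_natCast]
  simp

end

end MDP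

/-! ### Sample size -/

lemma natFloor_ge_half {x : ℝ} (hx : 2 ≤ x) : x / 2 ≤ ⌊x⌋₊ := by
  have := Nat.lt_floor_add_one x
  linarith

lemma log_actions_le [NeZero A] (hd : 1 ≤ d) (hH : 1 ≤ H) {δ : ℝ} (hδ : 0 < δ)
    (hδ1 : δ < 1) : Real.log A ≤ Real.log (d * A * H / δ) := by
  have hA : (0 : ℝ) < A := by exact_mod_cast Nat.pos_of_ne_zero (NeZero.ne A)
  have hd' : (1 : ℝ) ≤ d := by exact_mod_cast hd
  have hH' : (1 : ℝ) ≤ H := by exact_mod_cast hH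
  refine Real.log_le_log hA ((le_div_iff₀ hδ).2 ?_)
  calc (A : ℝ) * δ ≤ A * 1 := by gcongr
    _ ≤ A * (d * H) := by
        gcongr
        exact one_le_mul_of_one_le_of_one_le hd' hH'
    _ = _ := by ring

lemma sampleBound_nonneg [NeZero A] (k : ℕ) (hd : 1 ≤ d) (hH : 1 ≤ H) (ε : ℝ) {δ : ℝ} (hδ : 0 < δ)
    (hδ1 : δ < 1) : 0 ≤ sampleBound d S A H k ε δ := by
  have hA : (1 : ℝ) ≤ A := by exact_mod_cast Nat.one_le_iff_ne_zero.2 (NeZero.ne A)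
  have hL := (Real.log_nonneg hA).trans (log_actions_le (A := A) hd hH hδ hδ1)
  rw [sampleBound]
  positivity

/-- With at least two actions the prescribed sample size is positive, and the union bound over the
policies acting on `k` factors has total mass at most `δ / H`. -/
lemma sampleSize_spec [NeZero S] {k : ℕ} (hA : 2 ≤ A) (hd : 1 ≤ d) (hH : 1 ≤ H) (hk : 1 ≤ k)
    {C ε δ : ℝ} (hC : 8192 ≤ C) (hε : 0 < ε) (hε1 : ε < 1) (hδ : 0 < δ) (hδ1 : δ < 1) {N : ℕ}
    (hN : N = ⌊C * sampleBound d S A H k ε δ⌋₊) :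
    0 < N ∧ (d : ℝ) ^ k * (A : ℝ) ^ S ^ k * (2 * Real.exp (-(N *
      (precision S H k ε / (2 * k)) ^ 2 / (4 * (A * (H : ℝ) ^ 2))))) ≤ δ / H := by
  have : NeZero A := ⟨by omega⟩
  have hA' : (2 : ℝ) ≤ A := by exact_mod_cast hA
  have hd' : (1 : ℝ) ≤ d := by exact_mod_cast hd
  have hH' : (1 : ℝ) ≤ H := by exact_mod_cast hH
  have hk' : (1 : ℝ) ≤ k := by exact_mod_cast hk
  have hS' : (1 : ℝ) ≤ S := by exact_mod_cast Nat.one_le_iff_ne_zero.2 (NeZero.ne S)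
  have hs : (1 : ℝ) ≤ (S : ℝ) ^ k := one_le_pow₀ hS'
  set Z : ℝ := d * A * H / δ with hZ
  set L := Real.log Z with hL
  have hdA : (A : ℝ) ≤ d * A := le_mul_of_one_le_left (by positivity) hd'
  have hZ0 : 0 < Z := by positivity
  have hdZ : (d : ℝ) ≤ Z := (le_div_iff₀ hδ).2 <| by
    calc (d : ℝ) * δ ≤ d * (A * H) := by
          gcongr
          nlinarith
      _ = _ := by ring
  have hAZ : (A : ℝ) ≤ Z := (le_div_iff₀ hδ).2 <| by
    calc (A : ℝ) * δ ≤ A * (d * H) := by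
          gcongr
          nlinarith
      _ = _ := by ring
  have hHZ : Z⁻¹ ≤ δ / H := by
    rw [hZ, inv_div]
    gcongr
    exact le_mul_of_one_le_left (by positivity) (by linarith)
  have hL0 : (1 / 2 : ℝ) ≤ L := by
    have h1 : Real.log 2 ≤ L := Real.log_le_log (by norm_num) (hA'.trans hAZ)
    linarith [Real.log_two_gt_d9]
  have hbound : sampleBound d S A H k ε δ =
      A * (H : ℝ) ^ 4 * (k : ℝ) ^ 3 * ((S : ℝ) ^ k) ^ 3 * L / ε ^ 2 := by
    rw [sampleBound, mul_comm 3 k, pow_mul]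
  have hb2 : (1 / 2 : ℝ) ≤ sampleBound d S A H k ε δ := by
    rw [hbound, le_div_iff₀ (by positivity)]
    calc 1 / 2 * ε ^ 2 ≤ 1 / 2 * 1 := by
          gcongr
          exact pow_le_one₀ hε.le hε1.le
      _ = 1 * 1 * 1 * 1 * (1 / 2) := by norm_num
      _ ≤ _ := by
          gcongr
          · linarith
          · exact one_le_pow₀ hH'
          · exact one_le_pow₀ hk'
          · exact one_le_pow₀ hs
  -- flooring costs a factor two, since `C * sampleBound d S A H k ε δ` is at least two
  have hNr : 4096 * sampleBound d S A H k ε δ ≤ N := by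
    have h1 : 8192 * sampleBound d S A H k ε δ ≤ C * sampleBound d S A H k ε δ := by gcongr
    have h2 := natFloor_ge_half (x := C * sampleBound d S A H k ε δ) (by linarith)
    rw [← hN] at h2
    linarith
  refine ⟨by exact_mod_cast (show (0 : ℝ) < N by linarith), ?_⟩
  -- `4096 = 4 * 1024`, where `1024 = 4 * 16 ^ 2` comes from `b ^ 2 / (4 A H ^ 2)` with
  -- `b = ε / (16 k S ^ k H)`, and `2 + k + S ^ k ≤ 4 k S ^ k`
  have hX : (1 + k + (S : ℝ) ^ k) * L + L ≤
      N * (precision S H k ε / (2 * k)) ^ 2 / (4 * (A * (H : ℝ) ^ 2)) := by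
    calc (1 + k + (S : ℝ) ^ k) * L + L = (2 + k + (S : ℝ) ^ k) * L := by ring
      _ ≤ 4 * k * (S : ℝ) ^ k * L := by
          gcongr
          nlinarith [mul_nonneg (sub_nonneg.2 hk') (sub_nonneg.2 hs)]
      _ = 4096 * sampleBound d S A H k ε δ *
            (precision S H k ε / (2 * k)) ^ 2 / (4 * (A * (H : ℝ) ^ 2)) := by
          rw [hbound, precision]
          field_simp
          ring
      _ ≤ _ := by gcongr
  have hexp : Real.exp (-((1 + k + (S : ℝ) ^ k) * L + L)) = (Z ^ (1 + k + S ^ k))⁻¹ * Z⁻¹ := by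
    rw [neg_add, Real.exp_add, Real.exp_neg, Real.exp_neg, hL, Real.exp_log hZ0,
      ← Real.exp_log (pow_pos hZ0 (1 + k + S ^ k)), Real.log_pow]
    push_cast
    rfl
  calc _ ≤ Z ^ k * Z ^ S ^ k * (Z * Real.exp (-((1 + k + (S : ℝ) ^ k) * L + L))) := by
        gcongr
        linarith
    _ = Z ^ (1 + k + S ^ k) * (Z ^ (1 + k + S ^ k))⁻¹ * Z⁻¹ := by
        rw [hexp]
        ring
    _ = Z⁻¹ := by rw [mul_inv_cancel₀ (by positivity), one_mul]
    _ ≤ _ := hHZ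

/-! ### The backward loop -/

namespace MDP

variable {M : MDP d S A} [NeZero A]

/-- `σ` acts on the factors in `I` and is, up to `e`, optimal at layer `t` among such one-step
policies, for the roll-in `Ψ` and the roll-out `π`. -/
def IsGoodStep (M : MDP d S A) (I : Finset (Fin d)) (e : ℝ) (t : Fin H)
    (Ψ : Finset (Policy d S A H)) (π : Policy d S A H) (σ : OneStep d S A) : Prop :=
  ActsOn I σ ∧ ∀ σ', ActsOn I σ' → M.layerValue t Ψ π σ' ≤ M.layerValue t Ψ π σ + e

/-- One backward step succeeds with probability at least `1 - δ / H`. -/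
lemma IsExo.step_failure_le [NeZero S] (hM : M.IsExo I) {k : ℕ} (hI : I.card ≤ k) (hd : 1 ≤ d)
    (hH : 1 ≤ H) (hk : 1 ≤ k) {C ε δ : ℝ} (hC : 8192 ≤ C) (hε : 0 < ε) (hε1 : ε < 1) (hδ : 0 < δ)
    (hδ1 : δ < 1) {N : ℕ} (hN : N = ⌊C * sampleBound d S A H k ε δ⌋₊) {t : Fin H}
    {Ψ : Finset (Policy d S A H)} (hΨ : Ψ.Nonempty) (hΨI : ∀ ψ ∈ Ψ, Endogenous I ψ)
    {π : Policy d S A H} (hπ : Endogenous I π)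
    {out : (OneStep d S A → ℝ) → Option (OneStep d S A)}
    (hout : ∀ V, IsEPOOutput k (precision S H k ε) V (out V)) :
    (iid (M.trajLaw t Ψ hΨ π) N).toOuterMeasure {D | ¬ ∃ σ, out (Vhat t D) = some σ ∧
      M.IsGoodStep I (4 * precision S H k ε) t Ψ π σ} ≤ ENNReal.ofReal (δ / H) := by
  have hk' : (1 : ℝ) ≤ k := by exact_mod_cast hk
  have hH' : (1 : ℝ) ≤ H := by exact_mod_cast hH
  have hS' : (1 : ℝ) ≤ S := by exact_mod_cast Nat.one_le_iff_ne_zero.2 (NeZero.ne S)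
  have hs : (1 : ℝ) ≤ (S : ℝ) ^ k := one_le_pow₀ hS'
  have hp : 0 < precision S H k ε := by
    rw [precision]
    positivity
  have hp1 : precision S H k ε ≤ 1 := by
    rw [precision, div_le_one (by positivity)]
    nlinarith [one_le_mul_of_one_le_of_one_le hs hH']
  have hrestr := fun (J : Finset (Fin d)) (σ : OneStep d S A) (hσ : ActsOn J σ) =>
    hM.exists_actsOn_inter_le hΨI hπ t hσ
  rcases Nat.lt_or_ge A 2 with hA | hA
  · -- with a single action there is only one policy, and nothing has to be estimated
    have hsub : Subsingleton (OneStep d S A) := by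
      obtain rfl : A = 1 := by have := NeZero.ne A; omega
      infer_instance
    have hempty : {D : Fin N → Trajectory d S A H | ¬ ∃ σ, out (Vhat t D) = some σ ∧
        M.IsGoodStep I (4 * precision S H k ε) t Ψ π σ} = ∅ := by
      refine Set.eq_empty_of_forall_notMem fun D hD => hD ?_
      obtain ⟨σ, h1, h2, h3⟩ := IsEPOOutput.exists_eq_some (b := 0) (v := Vhat t D) hk hI hp
        (by rw [mul_zero]; positivity)
        (fun J σ hσ => ⟨σ, (hrestr J σ hσ).elim fun σ' h => Subsingleton.elim σ' σ ▸ h.1, le_rfl⟩)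
        (fun σ _ => by simp) (hout (Vhat t D))
      refine ⟨σ, h1, h2, fun σ' _ => ?_⟩
      rw [Subsingleton.elim σ' σ]
      linarith
    rw [hempty]
    simp
  · obtain ⟨hN0, htail⟩ := sampleSize_spec (S := S) hA hd hH hk hC hε hε1 hδ hδ1 hN
    have hb1 : precision S H k ε / (2 * k) ≤ 1 :=
      (div_le_self hp.le (by linarith)).trans hp1
    refine ((MeasureTheory.measure_mono ?_).trans (estimates_tail (k := k) hd hH t Ψ hΨ π
      (b := precision S H k ε / (2 * k)) (by positivity) hb1 hN0)).trans
      (ENNReal.ofReal_le_ofReal htail)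
    intro D hD
    by_contra hacc
    refine hD (IsEPOOutput.exists_eq_some (b := precision S H k ε / (2 * k)) hk hI hp
      (le_of_eq (by field_simp)) hrestr (fun σ hσ => ?_) (hout (Vhat t D)))
    by_contra hlt
    exact hacc ⟨σ, hσ, not_le.1 hlt⟩

/-- If every backward step fails with probability at most `c`, and `π` is good at all layers with
index at least `n`, then outside an event of probability `n c` the loop over the remaining `n`
layers outputs a policy that is good at every layer. -/
lemma psdpLoop_failure_le {N : ℕ} {Ψ : Fin H → Finset (Policy d S A H)}
    {hΨ : ∀ t, (Ψ t).Nonempty} {epo : Fin H → (OneStep d S A → ℝ) → Option (OneStep d S A)}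
    {e : ℝ} {c : ENNReal}
    (hstep : ∀ (t : Fin H) (π : Policy d S A H), Endogenous I π →
      (iid (M.trajLaw t (Ψ t) (hΨ t) π) N).toOuterMeasure {D | ¬ ∃ σ, epo t (Vhat t D) = some σ ∧
        M.IsGoodStep I e t (Ψ t) π σ} ≤ c) :
    ∀ (n : ℕ) (hn : n ≤ H) (π : Policy d S A H), Endogenous I π →
      (∀ t : Fin H, n ≤ t → M.IsGoodStep I e t (Ψ t) π (π t)) →
      (M.psdpLoop N Ψ hΨ epo n hn π).toOuterMeasure {out | ¬ ∃ π', out.1 = some π' ∧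
        Endogenous I π' ∧ ∀ t, M.IsGoodStep I e t (Ψ t) π' (π' t)} ≤ n * c
  | 0, _, π, hπ, hgood => by
    rw [psdpLoop, PMF.toOuterMeasure_pure_apply, if_neg]
    · simp
    · exact not_not.2 ⟨π, rfl, hπ, fun t => hgood t (Nat.zero_le _)⟩
  | n + 1, hn, π, hπ, hgood => by
    rw [psdpLoop]
    refine (toOuterMeasure_bind_le _ _ _ _ (n * c) fun D hD => ?_).trans
      ((add_le_add_left (hstep ⟨n, hn⟩ π hπ) (n * c)).trans_eq ?_)
    · obtain ⟨σ, hσ, hσg⟩ := not_not.1 hD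
      rw [hσ]
      simp only [PMF.toOuterMeasure_map_apply]
      have hcongr : ∀ t : Fin H, n ≤ t →
          M.layerValue t (Ψ t) (Function.update π ⟨n, hn⟩ σ) = M.layerValue t (Ψ t) π :=
        fun t ht => layerValue_congr t _ fun i hi => Function.update_of_ne
          (fun h => by subst h; exact absurd (Fin.lt_def.1 hi) (not_lt.2 ht)) _ _
      refine psdpLoop_failure_le hstep n _ (Function.update π ⟨n, hn⟩ σ) (fun t => ?_)
        fun t ht => ?_
      · by_cases h : t = ⟨n, hn⟩
        · subst h
          rw [Function.update_self]
          exact hσg.1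
        · rw [Function.update_of_ne h]
          exact hπ t
      · rw [IsGoodStep, hcongr t ht]
        by_cases h : t = ⟨n, hn⟩
        · subst h
          rw [Function.update_self]
          exact hσg
        · rw [Function.update_of_ne h]
          exact hgood t (lt_of_le_of_ne ht fun h' => h (Fin.ext h'.symm))
    · push_cast
      ring

lemma psdpLoop_trajectories_le {N : ℕ} {Ψ : Fin H → Finset (Policy d S A H)}
    {hΨ : ∀ t, (Ψ t).Nonempty} {epo : Fin H → (OneStep d S A → ℝ) → Option (OneStep d S A)} :
    ∀ (n : ℕ) (hn : n ≤ H) (π : Policy d S A H), ∀ out ∈ (M.psdpLoop N Ψ hΨ epo n hn π).support,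
      ∀ t : Fin H, out.2 t ≤ if (t : ℕ) < n then N else 0
  | 0, _, π, out, hout, t => by
    rw [psdpLoop, PMF.mem_support_pure_iff] at hout
    simp [hout]
  | n + 1, hn, π, out, hout, t => by
    rw [psdpLoop, PMF.mem_support_bind_iff] at hout
    obtain ⟨D, _, hD⟩ := hout
    have hsingle : (Pi.single ⟨n, hn⟩ N : Fin H → ℕ) t = if (t : ℕ) = n then N else 0 := by
      simp only [Pi.single_apply, Fin.ext_iff]
    split at hD
    · rw [PMF.mem_support_pure_iff] at hD
      subst hD
      simp only [hsingle]
      split_ifs <;> omega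
    · rw [PMF.mem_support_map_iff] at hD
      obtain ⟨out', hout', rfl⟩ := hD
      have := psdpLoop_trajectories_le n _ _ out' hout' t
      simp only [Pi.add_apply, hsingle]
      split_ifs at this ⊢ <;> omega

end MDP

end

end ExoMDP

theorem mainTheorem3 :
    ∃ C₀ : ℝ, 0 < C₀ ∧ ∀ C : ℝ, C₀ ≤ C →
      ∀ (d S A H k : ℕ) [NeZero S] [NeZero A], 1 ≤ d → 1 ≤ H → 1 ≤ k →
      ∀ (M : ExoMDP.MDP d S A) (Istar : Finset (Fin d)),
        M.IsExo Istar → Istar.card ≤ k →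
      ∀ η : ℝ, 0 < η → M.Reachable H Istar η →
      ∀ (Ψ : Fin H → Finset (ExoMDP.Policy d S A H)) (hΨ : ∀ t, (Ψ t).Nonempty),
        (∀ t, M.IsEndoCover Istar (η / 2) t (Ψ t)) → (∀ t, (Ψ t).card ≤ S ^ k) →
      ∀ ε δ : ℝ, 0 < ε → ε < 1 → 0 < δ → δ < 1 →
      ∀ epo : Fin H → (ExoMDP.OneStep d S A → ℝ) → Option (ExoMDP.OneStep d S A),
        ExoMDP.ImplementsEPO k (ExoMDP.precision S H k ε) epo →
      ∀ N : ℕ, N = ⌊C * ExoMDP.sampleBound d S A H k ε δ⌋₊ →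
        ENNReal.ofReal (1 - δ) ≤
          (M.exoPSDP N Ψ hΨ epo).toOuterMeasure
            {out | ∃ π : ExoMDP.Policy d S A H, out.1 = some π ∧
              ExoMDP.Endogenous Istar π ∧
              ∀ π' : ExoMDP.Policy d S A H, M.J π' ≤ M.J π + ε} ∧
        ∀ out ∈ (M.exoPSDP N Ψ hΨ epo).support,
          (∀ t, (out.2 t : ℝ) ≤ C * ExoMDP.sampleBound d S A H k ε δ) ∧
          (∑ t, (out.2 t : ℝ)) ≤ H * (C * ExoMDP.sampleBound d S A H k ε δ) := by
  refine ⟨8192, by norm_num, ?_⟩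
  intro C hC d S A H k _ _ hd hH hk M I hM hI η _ hreach Ψ hΨ hcov hcard ε δ hε hε1 hδ hδ1 epo hepo
    N hN
  have hH' : (0 : ℝ) < H := by exact_mod_cast hH
  have hS' : (0 : ℝ) < S := by exact_mod_cast Nat.pos_of_ne_zero (NeZero.ne S)
  refine ⟨ExoMDP.ofReal_one_sub_le_toOuterMeasure _ _ hδ.le ?_, fun out hout => ?_⟩
  · have hfail := ExoMDP.MDP.psdpLoop_failure_le (M := M) (I := I) (hΨ := hΨ) (epo := epo)
      (fun t π hπ => hM.step_failure_le hI hd hH hk hC hε hε1 hδ hδ1 hN (hΨ t) (hcov t).2 hπ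
        (hepo t)) H le_rfl (fun _ _ => 0) (fun _ _ _ _ => rfl)
      fun t ht => absurd t.isLt (not_lt.2 ht)
    have hδH : (H : ENNReal) * ENNReal.ofReal (δ / H) = ENNReal.ofReal δ := by
      rw [← ENNReal.ofReal_natCast, ← ENNReal.ofReal_mul hH'.le, mul_div_cancel₀ _ hH'.ne']
    rw [hδH] at hfail
    refine (MeasureTheory.measure_mono fun out hout => ?_).trans hfail
    rintro ⟨π, hπ, hπI, hgood⟩
    refine hout ⟨π, hπ, hπI, fun π' => ?_⟩
    refine (hM.J_le_of_layerValue_le hreach hΨ hcov hπI (fun t => (hgood t).2) π').trans ?_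
    gcongr
    calc ∑ t, 2 * ((Ψ t).card : ℝ) * (4 * ExoMDP.precision S H k ε)
        ≤ ∑ _t : Fin H, 2 * (S : ℝ) ^ k * (4 * ExoMDP.precision S H k ε) := by
          have hp : 0 ≤ ExoMDP.precision S H k ε := by
            rw [ExoMDP.precision]
            positivity
          refine Finset.sum_le_sum fun t _ => ?_
          gcongr
          exact_mod_cast hcard t
      _ = ε := by
          rw [Finset.sum_const, Finset.card_univ, Fintype.card_fin, nsmul_eq_mul,
            ExoMDP.precision]
          field_simp
          ring
  · have hbound : (N : ℝ) ≤ C * ExoMDP.sampleBound d S A H k ε δ := by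
      rw [hN]
      exact Nat.floor_le (mul_nonneg (by linarith)
        (ExoMDP.sampleBound_nonneg k hd hH ε hδ hδ1))
    have hle : ∀ t, (out.2 t : ℝ) ≤ C * ExoMDP.sampleBound d S A H k ε δ := fun t => by
      have := ExoMDP.MDP.psdpLoop_trajectories_le H le_rfl _ out hout t
      rw [if_pos t.isLt] at this
      exact le_trans (by exact_mod_cast this) hbound
    refine ⟨hle, (Finset.sum_le_sum fun t _ => hle t).trans_eq ?_⟩
    simp
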